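/- Let $F$ be a field of characteristic $0$ (for example a local field) and let $D$ be a finite-dimensional division algebra over $F$ with an $F$-linear involution (anti-automorphism of order at most $2$) $a\mapsto a^\natural$. For $\epsilon=\pm1$, an $\epsilon$-Hermitian $D$-space is a finitely generated right $D$-module $V$ with a non-degenerate $F$-bilinear form $B:V\times V\to D$ such that $B(ua,v)=B(u,v)a$ and $B(u,v)=\epsilon B(v,u)^\natural$. Let $(V,B)$ be an $\epsilon$-Hermitian $D$-space and $(V',B')$ an $\epsilon'$-Hermitian $D$-space with $\epsilon\epsilon'=-1$. Let $\mathfrak g'$ be the Lie algebra of the isometry group of $(V',B')$, that is, the space of all $X\in\operatorname{End}_D(V')$ with $B'(Xu,v)+B'(u,Xv)=0$. For $T\in\operatorname{Hom}_D(V,V')$ let $T^*\in\operatorname{Hom}_D(V',V)$ be its adjoint, $B'(Tv,v')=B(v,T^*v')$, and let $\varphi':\operatorname{Hom}_D(V,V')\to\mathfrak g'$, $\varphi'(T)=TT^*$, be the moment map. For $m\ge1$ let $S_m$ be the irreducible $m$-dimensional representation over $F$ of $\mathfrak{sl}_2=\langle X,H,Y\rangle$ ($[H,X]=2X$, $[H,Y]=-2Y$,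 $[X,Y]=H$), with a highest weight vector $e_m$, and fix non-degenerate $\mathfrak{sl}_2$-invariant bilinear forms $(\cdot,\cdot)_m$ on the $S_m$ which are compatibly normalized: for every $m\ge1$ the quotient $(e_m,Y^{m-1}e_m)_m/(e_{m+1},Y^{m}e_{m+1})_{m+1}$ is a square in $F^\times$. Let $\gamma'=\{X',H',Y'\}\subset\mathfrak g'$ be an $\mathfrak{sl}_2$-triple (possibly zero). For $m\ge 1$ let $(V')^{\gamma',m}$ be the sum of all irreducible $m$-dimensional (over $F$) $\gamma'$-submodules of $V'$, and for $t\geq 1$ let $(V')^{\gamma',t+1}_{t}$ be the space of highest weight vectors (which have $H'$-weight $t$) in $(V')^{\gamma',t+1}$, with the form $$B^{\gamma',t+1}_{t}(v,w)=\frac{B'(v,Y'^{\,t}w)}{(e_{t+1},Y^{t}e_{t+1})_{t+1}},$$ which is the form making $v\otimes Y^ke_{t+1}\mapsto Y'^kv$ an isometry $(V')^{\gamma',t+1}_{t}\otimes S_{t+1}\cong (V')^{\gamma',t+1}$. Let $t_1>\dots>t_l\geq 1$ be integers that include every $t\ge1$ with $(V')^{\gamma',t+1}\ne0$. Then $X'$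 lies in the image of $\varphi'$ if and only if there is an embedding of $\epsilon$-Hermitian spaces (an injective, form-preserving, $D$-linear map) $$\bigoplus_{1\le j\le l}\big((V')^{\gamma',t_j+1}_{t_j},B^{\gamma',t_j+1}_{t_j}\big)\otimes\big(S_{t_j},(\cdot,\cdot)_{t_j}\big)\hookrightarrow (V,B).$$ -/

import Mathlib

open scoped TensorProduct Matrix
open MulOpposite (op)

/-! Right `D`-modules are modules over `Dᵐᵒᵖ`; `op a • v` is `v` multiplied by `a` on the right.
`star` is the involution of `D`. -/

/-- A (non-degenerate) `ε`-Hermitian form on a right `D`-module `V`. -/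
structure EpsHermitianForm (F D : Type*) [Field F] [DivisionRing D] [Algebra F D] [StarRing D]
    (ε : ℤˣ) (V : Type*) [AddCommGroup V] [Module F V] [Module Dᵐᵒᵖ V]
    [IsScalarTower F Dᵐᵒᵖ V] where
  form : V →ₗ[F] V →ₗ[F] D
  smul_left : ∀ (a : D) (u v : V), form (op a • u) v = form u v * a
  herm : ∀ u v : V, form u v = (ε : ℤ) • star (form v u)
  nondeg : ∀ u : V, (∀ v : V, form u v = 0) → u = 0

namespace EpsHermitianForm

variable {F D : Type*} [Field F] [DivisionRing D] [Algebra F D] [StarRing D] {ε ε' : ℤˣ}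
  {V : Type*} [AddCommGroup V] [Module F V] [Module Dᵐᵒᵖ V] [IsScalarTower F Dᵐᵒᵖ V]
  {V' : Type*} [AddCommGroup V'] [Module F V'] [Module Dᵐᵒᵖ V'] [IsScalarTower F Dᵐᵒᵖ V']

theorem smul_right (B : EpsHermitianForm F D ε V) (a : D) (u v : V) :
    B.form u (op a • v) = star a * B.form u v := by
  rw [B.herm u (op a • v), B.smul_left, star_mul, B.herm u v, mul_smul_comm]

theorem nondeg_right (B : EpsHermitianForm F D ε V) (w : V) (h : ∀ v, B.form v w = 0) :
    w = 0 :=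
  B.nondeg w fun v => by rw [B.herm, h v, star_zero, smul_zero]

/-- The `Dᵐᵒᵖ`-linear functional `v ↦ B(v, w)`. -/
def functional (B : EpsHermitianForm F D ε V) (w : V) : V →ₗ[Dᵐᵒᵖ] D where
  toFun v := B.form v w
  map_add' u v := by simp
  map_smul' a v := by
    obtain ⟨a, rfl⟩ := MulOpposite.op_surjective a
    simpa using B.smul_left a v w

/-- `w ↦ B(·, w)` as an `F`-linear map. -/
def toDual (B : EpsHermitianForm F D ε V) : V →ₗ[F] (V →ₗ[Dᵐᵒᵖ] D) where
  toFun w := B.functional w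
  map_add' u v := by ext x; simp [functional]
  map_smul' a v := by ext x; simp [functional]

variable [FiniteDimensional F D] [Module.Finite Dᵐᵒᵖ V]

/-- Riesz representation. -/
theorem toDual_bijective (B : EpsHermitianForm F D ε V) : Function.Bijective B.toDual := by
  have hinj : Function.Injective B.toDual := by
    rw [← LinearMap.ker_eq_bot, LinearMap.ker_eq_bot']
    intro w hw
    exact B.nondeg_right w fun v => LinearMap.congr_fun hw v
  have : FiniteDimensional F Dᵐᵒᵖ :=
    Module.Finite.equiv (MulOpposite.opLinearEquiv F : D ≃ₗ[F] Dᵐᵒᵖ)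
  have : FiniteDimensional F V := Module.Finite.trans Dᵐᵒᵖ V
  let b := Module.finBasis Dᵐᵒᵖ V
  let e : (Fin (Module.finrank Dᵐᵒᵖ V) → D) ≃ₗ[F] (V →ₗ[Dᵐᵒᵖ] D) := b.constr F
  have : FiniteDimensional F (V →ₗ[Dᵐᵒᵖ] D) := Module.Finite.equiv e
  have hdim : Module.finrank F V = Module.finrank F (V →ₗ[Dᵐᵒᵖ] D) := by
    rw [← e.finrank_eq, Module.finrank_pi_fintype, ← Module.finrank_mul_finrank F Dᵐᵒᵖ V,
      ← (MulOpposite.opLinearEquiv F : D ≃ₗ[F] Dᵐᵒᵖ).finrank_eq]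
    simp [mul_comm]
  exact ⟨hinj, (LinearMap.injective_iff_surjective_of_finrank_eq_finrank hdim).1 hinj⟩

theorem exists_adjoint (B : EpsHermitianForm F D ε V) (B' : EpsHermitianForm F D ε' V')
    (T : V →ₗ[Dᵐᵒᵖ] V') :
    ∃ S : V' →ₗ[Dᵐᵒᵖ] V, ∀ v v', B'.form (T v) v' = B.form v (S v') := by
  have hex : ∀ v' : V', ∃ w : V, ∀ v, B'.form (T v) v' = B.form v w := fun v' => by
    obtain ⟨w, hw⟩ := B.toDual_bijective.2 (B'.functional v' ∘ₗ T)
    exact ⟨w, fun v => (LinearMap.congr_fun hw v).symm⟩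
  choose S hS using hex
  refine ⟨{ toFun := S, map_add' := fun x y => ?_, map_smul' := fun a x => ?_ }, fun v v' => hS v' v⟩
  · refine sub_eq_zero.1 (B.nondeg_right _ fun v => ?_)
    simp [← hS]
  · obtain ⟨a, rfl⟩ := MulOpposite.op_surjective a
    refine sub_eq_zero.1 (B.nondeg_right _ fun v => ?_)
    simp [← hS, smul_right]

/-- The adjoint `T* : V' → V` of `T : V → V'`, determined by `B'(T v, v') = B(v, T* v')`. -/
noncomputable def adjoint (B : EpsHermitianForm F D ε V) (B' : EpsHermitianForm F D ε' V')
    (T : V →ₗ[Dᵐᵒᵖ] V') : V' →ₗ[Dᵐᵒᵖ] V :=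
  Classical.choose (exists_adjoint B B' T)

theorem adjoint_spec (B : EpsHermitianForm F D ε V) (B' : EpsHermitianForm F D ε' V')
    (T : V →ₗ[Dᵐᵒᵖ] V') (v : V) (v' : V') :
    B'.form (T v) v' = B.form v (adjoint B B' T v') :=
  Classical.choose_spec (exists_adjoint B B' T) v v'

end EpsHermitianForm

namespace EpsHermitianForm

variable {F D : Type*} [Field F] [DivisionRing D] [Algebra F D] [StarRing D] {ε : ℤˣ}
  {V : Type*} [AddCommGroup V] [Module F V] [Module Dᵐᵒᵖ V] [IsScalarTower F Dᵐᵒᵖ V]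
  {V' : Type*} [AddCommGroup V'] [Module F V'] [Module Dᵐᵒᵖ V'] [IsScalarTower F Dᵐᵒᵖ V']

/-- The Lie algebra of the isometry group of `(V, B)`; the bracket is the commutator. -/
def lieAlgebra (B : EpsHermitianForm F D ε V) : Submodule F (Module.End Dᵐᵒᵖ V) where
  carrier := {X | ∀ u v, B.form (X u) v + B.form u (X v) = 0}
  add_mem' {X Y} hX hY u v := by
    have h1 := hX u v
    have h2 := hY u v
    calc B.form ((X + Y) u) v + B.form u ((X + Y) v)
        = (B.form (X u) v + B.form u (X v)) + (B.form (Y u) v + B.form u (Y v)) := by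
          simp only [LinearMap.add_apply, map_add]; abel
      _ = 0 := by rw [h1, h2, add_zero]
  zero_mem' u v := by simp
  smul_mem' c X hX u v := by
    have h1 := hX u v
    simp only [LinearMap.smul_apply, map_smul]
    rw [← smul_add, h1, smul_zero]

theorem lie_mem (B : EpsHermitianForm F D ε V) {X Y : Module.End Dᵐᵒᵖ V}
    (hX : X ∈ B.lieAlgebra) (hY : Y ∈ B.lieAlgebra) : ⁅X, Y⁆ ∈ B.lieAlgebra := fun u v => by
  have hX' : ∀ u v, B.form (X u) v = - B.form u (X v) :=
    fun u v => eq_neg_of_add_eq_zero_left (hX u v)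
  have hY' : ∀ u v, B.form (Y u) v = - B.form u (Y v) :=
    fun u v => eq_neg_of_add_eq_zero_left (hY u v)
  simp only [Ring.lie_def, LinearMap.sub_apply, Module.End.mul_apply, map_sub, hX', hY', neg_neg]
  abel

/-- The moment map `φ' : Hom_D(V, V') → 𝔤'`, `T ↦ T T*`; here `V` is `ε`-Hermitian and `V'` is
`(-ε)`-Hermitian. -/
noncomputable def momentMap' [FiniteDimensional F D] [Module.Finite Dᵐᵒᵖ V]
    (B : EpsHermitianForm F D ε V) (B' : EpsHermitianForm F D (-ε) V')
    (T : V →ₗ[Dᵐᵒᵖ] V') : B'.lieAlgebra :=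
  ⟨T ∘ₗ adjoint B B' T, fun u v => by
    simp only [LinearMap.comp_apply]
    rw [B'.herm u, adjoint_spec B B', adjoint_spec B B', B.herm (adjoint B B' T u)]
    simp⟩

/-- An `𝔰𝔩₂`-triple in the Lie algebra of `(V, B)` (the zero triple is allowed). -/
structure Sl2Triple (B : EpsHermitianForm F D ε V) where
  X : B.lieAlgebra
  H : B.lieAlgebra
  Y : B.lieAlgebra
  lie_H_X : ⁅H.1, X.1⁆ = (2 : ℕ) • X.1
  lie_H_Y : ⁅H.1, Y.1⁆ = -((2 : ℕ) • Y.1)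
  lie_X_Y : ⁅X.1, Y.1⁆ = H.1

namespace Sl2Triple

variable {B : EpsHermitianForm F D ε V} (γ : Sl2Triple B)

/-- `W` is stable under the span of `X, H, Y`. -/
def Stable (W : Submodule F V) : Prop :=
  ∀ w ∈ W, γ.X.1 w ∈ W ∧ γ.H.1 w ∈ W ∧ γ.Y.1 w ∈ W

/-- `W` is an irreducible module under the span of `X, H, Y`. -/
def Irred (W : Submodule F V) : Prop :=
  γ.Stable W ∧ W ≠ ⊥ ∧ ∀ U : Submodule F V, U ≤ W → γ.Stable U → U = ⊥ ∨ U = W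

/-- The isotypic component `V^{γ, m}`, generated by the irreducible submodules of `V` that have
dimension `m` over `F`. -/
def isotypic (m : ℕ) : Submodule Dᵐᵒᵖ V :=
  Submodule.span Dᵐᵒᵖ {v | ∃ W : Submodule F V, γ.Irred W ∧ Module.finrank F W = m ∧ v ∈ W}

/-- The multiplicity space `V^{γ, n+1}_n`: the highest weight vectors (necessarily of `H`-weight
`n`) in `V^{γ, n+1}`. -/
def mult (n : ℕ) : Submodule Dᵐᵒᵖ V :=
  γ.isotypic (n + 1) ⊓ LinearMap.ker γ.X.1 ⊓ LinearMap.ker (γ.H.1 - (n : Module.End Dᵐᵒᵖ V))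

end Sl2Triple

end EpsHermitianForm

/-! ### The irreducible representations `S_m` of `𝔰𝔩₂` and their invariant forms

`S_m` is `F^m` with basis `e₀, …, e_{m-1}`, where `e₀` is a highest weight vector and
`Y eᵢ = e_{i+1}`, `H eᵢ = (m-1-2i) eᵢ`, `X eᵢ = i(m-i) e_{i-1}`. -/

/-- The matrix of `X` on `S_m`. -/
def stdX (F : Type*) [Field F] (m : ℕ) : Matrix (Fin m) (Fin m) F :=
  Matrix.of fun i j => if (j : ℕ) = i + 1 then (j : F) * ((m : F) - (j : F)) else 0

/-- The matrix of `H` on `S_m`. -/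
def stdH (F : Type*) [Field F] (m : ℕ) : Matrix (Fin m) (Fin m) F :=
  Matrix.diagonal fun i => (m : F) - 1 - 2 * (i : F)

/-- The matrix of `Y` on `S_m`. -/
def stdY (F : Type*) [Field F] (m : ℕ) : Matrix (Fin m) (Fin m) F :=
  Matrix.of fun i j => if (i : ℕ) = j + 1 then 1 else 0

/-- A non-degenerate `𝔰𝔩₂`-invariant bilinear form on `S_m`. -/
structure IsInvariantForm {F : Type*} [Field F] {m : ℕ}
    (β : LinearMap.BilinForm F (Fin m → F)) : Prop where
  nondeg : β.Nondegenerate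
  inv_X : ∀ u v, β (stdX F m *ᵥ u) v + β u (stdX F m *ᵥ v) = 0
  inv_H : ∀ u v, β (stdH F m *ᵥ u) v + β u (stdH F m *ᵥ v) = 0
  inv_Y : ∀ u v, β (stdY F m *ᵥ u) v + β u (stdY F m *ᵥ v) = 0

/-- The scalar `(e, Yⁿ e)` attached to a form on `S_{n+1}`, where `e` is the highest weight
vector `e₀`; it determines an invariant form. -/
def normConst {F : Type*} [Field F] (n : ℕ) (β : LinearMap.BilinForm F (Fin (n + 1) → F)) : F :=
  β (Pi.single 0 1) ((stdY F (n + 1) ^ n) *ᵥ Pi.single 0 1)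

namespace EpsHermitianForm

variable {F D : Type*} [Field F] [DivisionRing D] [Algebra F D] [StarRing D] {ε : ℤˣ}
  {V : Type*} [AddCommGroup V] [Module F V] [Module Dᵐᵒᵖ V] [IsScalarTower F Dᵐᵒᵖ V]
  {B : EpsHermitianForm F D ε V}

/-- The form on the multiplicity space `V^{γ, n+1}_n` induced by `B` and the invariant form `β` on
`S_{n+1}`: the unique form for which `V^{γ, n+1}_n ⊗ S_{n+1} → V^{γ, n+1}`, `v ⊗ Yᵏ e ↦ Yᵏ v`, is
isometric, namely `(v, w) ↦ B(v, Yⁿ w) / β(e, Yⁿ e)`. -/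
def Sl2Triple.multForm (γ : Sl2Triple B) (n : ℕ)
    (β : LinearMap.BilinForm F (Fin (n + 1) → F)) : γ.mult n →ₗ[F] γ.mult n →ₗ[F] D :=
  LinearMap.mk₂ F (fun v w => (normConst n β)⁻¹ • B.form v ((γ.Y.1 ^ n) (w : V)))
    (fun v v' w => by simp) (fun c v w => by simp [smul_comm c])
    (fun v w w' => by simp)
    (fun c v w => by simp [LinearMap.map_smul_of_tower, smul_comm c])

end EpsHermitianForm

/-- The form `(u ⊗ x, v ⊗ y) ↦ C(u, v) β(x, y)` on `M ⊗ S`. -/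
noncomputable def tensorForm {F D M S : Type*} [Field F] [DivisionRing D] [Algebra F D]
    [AddCommGroup M] [Module F M] [AddCommGroup S] [Module F S]
    (C : M →ₗ[F] M →ₗ[F] D) (β : LinearMap.BilinForm F S) :
    (M ⊗[F] S) →ₗ[F] (M ⊗[F] S) →ₗ[F] D :=
  (TensorProduct.map₂ C β).compr₂ (TensorProduct.rid F D).toLinearMap

/-- The orthogonal direct sum of finitely many formed spaces. -/
def sumForm {F D ι : Type*} [Field F] [DivisionRing D] [Algebra F D] [Fintype ι]
    {M : ι → Type*} [∀ i, AddCommGroup (M i)] [∀ i, Module F (M i)]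
    (C : ∀ i, M i →ₗ[F] M i →ₗ[F] D) : (∀ i, M i) →ₗ[F] (∀ i, M i) →ₗ[F] D :=
  ∑ i, (C i).compl₁₂ (LinearMap.proj i) (LinearMap.proj i)

/-!
The adjoint `S = T*` of a map `T : V → V'` with `T T* = X'` satisfies `B(S u, S v) = B'(X' u, v)`, and
any `D`-linear `S : V' → V` with this property is the adjoint of such a `T`
(`mem_range_momentMap'_iff`). So `X'` is in the image of the moment map iff the form
`C(u, v) = B'(X' u, v)`, whose radical is `ker X'`, is pulled back from `B` along a `D`-linear map; as
`V' / ker X'` is non-degenerate for `C`, this means that it embeds isometrically into `V`.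

It remains to identify `V' / ker X'` with the sum of the `V'^{γ', t_j+1}_{t_j} ⊗ S_{t_j}`. The
identification is `shiftMap`, `v ⊗ e_i ↦ c_j / (i + 1) • Y'^{i+1} v`: since
`X' Y'^{i+1} v = (i + 1)(t_j - i) Y'^i v`, it turns `C` into the form of the statement precisely when
`c_j²` is the quotient of the constants of the invariant forms on `S_{t_j}` and `S_{t_j+1}`
(`form_X_shiftMap`, `exists_scaling`). That `X' ∘ shiftMap` is injective with the same range as `X'`
comes from complete reducibility of the `𝔰𝔩₂`-module `V'` over a field of characteristic zero that
need not be algebraically closed: `V'` is spanned by the `Y'^i v` with `v` primitive of weight `n`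
and `i ≤ n` (`Sl2Endos.eq_top_of_pow_Y_mem`), and these are independent
(`Sl2Endos.eq_zero_of_sum_pow_Y_eq_zero`). The proof of the former decomposes `V'` into generalized
eigenspaces of the Casimir operator; on the one for `n(n+2)` every vector killed by `X'` has weight
`n`, which forces `H'` to be diagonalizable there.
-/

/-! ### Polynomials in an endomorphism -/

section

open Polynomial

theorem aeval_apply_eq_eval_smul {F V : Type*} [Field F] [AddCommGroup V] [Module F V]
    (f : Module.End F V) (p : F[X]) {μ : F} {v : V} (hv : f v = μ • v) :
    aeval f p v = p.eval μ • v := by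
  by_cases h0 : v = 0
  · simp [h0]
  · exact Module.End.aeval_apply_of_hasEigenvector ⟨Module.End.mem_eigenspace_iff.2 hv, h0⟩

theorem aeval_apply_of_commute {F V : Type*} [Field F] [AddCommGroup V] [Module F V]
    {f Z : Module.End F V} (hZ : ∀ v, f (Z v) = Z (f v)) (p : F[X]) (v : V) :
    aeval f p (Z v) = Z (aeval f p v) := by
  have hc : Commute f Z := LinearMap.ext hZ
  have : Commute (aeval f p) Z := by
    induction p using Polynomial.induction_on' with
    | add p q hp hq => rw [map_add]; exact hp.add_left hq
    | monomial n a =>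
      rw [aeval_monomial]
      exact Commute.mul_left (Algebra.commutes a Z) (hc.pow_left n)
  exact LinearMap.congr_fun this v

theorem aeval_apply_mem_of_invariant {F V : Type*} [Field F] [AddCommGroup V] [Module F V]
    {f : Module.End F V} {W : Submodule F V} (hW : ∀ w ∈ W, f w ∈ W) (p : F[X]) {w : V}
    (hw : w ∈ W) : aeval f p w ∈ W := by
  induction p using Polynomial.induction_on' generalizing w with
  | add p q hp hq => simpa using W.add_mem (hp hw) (hq hw)
  | monomial n a =>
    rw [aeval_monomial, Module.End.mul_apply, Module.algebraMap_end_apply]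
    refine W.smul_mem _ ?_
    induction n generalizing w with
    | zero => simpa
    | succ n ih => rw [pow_succ, Module.End.mul_apply]; exact ih (hW w hw)

/-- If a product of pairwise coprime polynomials in `f` kills `v ∈ W`, then `v` lies in any subspace
that contains, for each factor `q i`, the vectors of the invariant subspace `W` killed by `q i`. -/
theorem mem_of_aeval_prod_eq_zero {F V ι : Type*} [Field F] [AddCommGroup V] [Module F V]
    {f : Module.End F V} {W : Submodule F V} (hW : ∀ w ∈ W, f w ∈ W) (U : Submodule F V)
    {s : Finset ι} {q : ι → F[X]} (hq : (s : Set ι).Pairwise fun i j => IsCoprime (q i) (q j))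
    (hU : ∀ i ∈ s, ∀ w ∈ W, aeval f (q i) w = 0 → w ∈ U)
    {v : V} (hv : v ∈ W) (h : aeval f (∏ i ∈ s, q i) v = 0) : v ∈ U := by
  classical
  induction s using Finset.induction_on generalizing v with
  | empty => simp at h; simp [h]
  | insert a s ha ih =>
    rw [Finset.prod_insert ha] at h
    have hcop : IsCoprime (q a) (∏ i ∈ s, q i) := IsCoprime.prod_right fun i hi =>
      hq (by simp) (by simp [hi]) (by rintro rfl; exact ha hi)
    obtain ⟨c, d, hcd⟩ := hcop
    have hdec : v = aeval f (c * q a) v + aeval f (d * ∏ i ∈ s, q i) v := by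
      rw [← LinearMap.add_apply, ← map_add, hcd]; simp
    rw [hdec]
    refine U.add_mem (ih ?_ ?_ (aeval_apply_mem_of_invariant hW _ hv) ?_)
      (hU a (by simp) _ (aeval_apply_mem_of_invariant hW _ hv) ?_)
    · exact hq.mono (by simp)
    · exact fun i hi => hU i (by simp [hi])
    · rw [← Module.End.mul_apply, ← map_mul,
        show (∏ i ∈ s, q i) * (c * q a) = c * (q a * ∏ i ∈ s, q i) by ring, map_mul,
        Module.End.mul_apply, h, map_zero]
    · rw [← Module.End.mul_apply, ← map_mul,
        show q a * (d * ∏ i ∈ s, q i) = d * (q a * ∏ i ∈ s, q i) by ring, map_mul,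
        Module.End.mul_apply, h, map_zero]

/-! ### Complete reducibility of representations of `𝔰𝔩₂` -/

/-- Endomorphisms `X, H, Y` satisfying the relations of `𝔰𝔩₂`; unlike `IsSl2Triple`, `H = 0` is
allowed. -/
structure Sl2Endos {F V : Type*} [Field F] [AddCommGroup V] [Module F V]
    (X H Y : Module.End F V) : Prop where
  H_X : ∀ v, H (X v) = X (H v) + (2 : F) • X v
  H_Y : ∀ v, H (Y v) = Y (H v) - (2 : F) • Y v
  X_Y : ∀ v, X (Y v) = Y (X v) + H v

namespace Sl2Endos

variable {F V : Type*} [Field F] [AddCommGroup V] [Module F V] {X H Y : Module.End F V}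

theorem symm (h : Sl2Endos X H Y) : Sl2Endos Y (-H) X where
  H_X v := by simp [h.H_Y v]; abel
  H_Y v := by simp [h.H_X v]; abel
  X_Y v := by simp [h.X_Y v]

/-- The Casimir operator `4YX + H² + 2H`. -/
def casimir (X H Y : Module.End F V) : Module.End F V := (4 : F) • (Y * X) + H * H + (2 : F) • H

theorem casimir_apply (v : V) :
    casimir X H Y v = (4 : F) • Y (X v) + H (H v) + (2 : F) • H v := rfl

theorem casimir_symm (h : Sl2Endos X H Y) : casimir Y (-H) X = casimir X H Y := by
  ext v
  simp only [casimir_apply, LinearMap.neg_apply, map_neg, h.X_Y, smul_add]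
  module

theorem casimir_X (h : Sl2Endos X H Y) (v : V) : casimir X H Y (X v) = X (casimir X H Y v) := by
  simp only [casimir_apply, map_add, map_smul, h.H_X, h.X_Y]
  module

theorem casimir_Y (h : Sl2Endos X H Y) (v : V) : casimir X H Y (Y v) = Y (casimir X H Y v) := by
  rw [← h.casimir_symm]; exact h.symm.casimir_X v

theorem casimir_H (h : Sl2Endos X H Y) (v : V) : casimir X H Y (H v) = H (casimir X H Y v) := by
  simp only [casimir_apply, map_add, map_smul, h.H_X, h.H_Y]
  module

theorem H_pow_Y (h : Sl2Endos X H Y) {μ : F} {v : V} (hv : H v = μ • v) (k : ℕ) :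
    H ((Y ^ k) v) = (μ - 2 * k) • (Y ^ k) v := by
  induction k with
  | zero => simpa
  | succ k ih =>
    rw [pow_succ', Module.End.mul_apply, h.H_Y, ih]
    push_cast
    rw [map_smul]
    module

/-- On `ker X` one has `X Y^{k+1} = (k + 1) Y^k (H - k)`. -/
theorem X_pow_succ_Y (h : Sl2Endos X H Y) {v : V} (hv : X v = 0) (k : ℕ) :
    X ((Y ^ (k + 1)) v) = (k + 1 : F) • (Y ^ k) (H v - (k : F) • v) := by
  have hH : ∀ k : ℕ, H ((Y ^ k) v) = (Y ^ k) (H v) - (2 * k : F) • (Y ^ k) v := by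
    intro k
    induction k with
    | zero => simp
    | succ k ih =>
      rw [pow_succ', Module.End.mul_apply, h.H_Y, ih, Module.End.mul_apply, map_sub, map_smul]
      push_cast
      module
  induction k with
  | zero => simp [h.X_Y, hv]
  | succ k ih =>
    rw [pow_succ', Module.End.mul_apply, h.X_Y, ih, hH]
    simp only [map_sub, map_smul, pow_succ' Y k, Module.End.mul_apply]
    push_cast
    module

theorem X_pow_succ_Y_of_weight (h : Sl2Endos X H Y) {μ : F} {v : V} (hv : X v = 0)
    (hH : H v = μ • v) (k : ℕ) :
    X ((Y ^ (k + 1)) v) = ((k + 1) * (μ - k)) • (Y ^ k) v := by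
  rw [h.X_pow_succ_Y hv, hH, ← sub_smul, map_smul, smul_smul]

theorem X_pow_Y_pow (h : Sl2Endos X H Y) {v : V} (hv : X v = 0) (k : ℕ) :
    (X ^ k) ((Y ^ k) v) =
      (k.factorial : F) • aeval H (∏ j ∈ Finset.range k, (Polynomial.X - C (j : F))) v := by
  induction k generalizing v with
  | zero => simp
  | succ k ih =>
    have hw : X (H v - (k : F) • v) = 0 := by
      have := h.H_X v
      rw [hv] at this
      simp only [map_zero, smul_zero, add_zero] at this
      simp [hv, ← this]
    rw [pow_succ X, Module.End.mul_apply, h.X_pow_succ_Y hv, map_smul, ih hw,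
      Finset.prod_range_succ, map_mul, Module.End.mul_apply, smul_smul, Nat.factorial_succ]
    simp [-map_natCast, mul_comm]

theorem casimir_of_primitive {μ : F} {v : V} (hv : X v = 0)
    (hH : H v = μ • v) : casimir X H Y v = (μ * (μ + 2)) • v := by
  rw [casimir_apply, hv, hH, map_smul, hH, map_zero]
  module

theorem casimir_pow_Y (h : Sl2Endos X H Y) {μ : F} {v : V} (hv : casimir X H Y v = μ • v) (k : ℕ) :
    casimir X H Y ((Y ^ k) v) = μ • (Y ^ k) v := by
  induction k with
  | zero => simpa
  | succ k ih => rw [pow_succ', Module.End.mul_apply, h.casimir_Y, ih, map_smul]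

theorem aeval_casimir_X (h : Sl2Endos X H Y) (p : F[X]) (v : V) :
    aeval (casimir X H Y) p (X v) = X (aeval (casimir X H Y) p v) :=
  aeval_apply_of_commute h.casimir_X p v

theorem aeval_H_X (h : Sl2Endos X H Y) (a : ℕ → F) (k : ℕ) (v : V) :
    aeval H (∏ i ∈ Finset.range k, (Polynomial.X - C (a i))) (X v) =
      X (aeval H (∏ i ∈ Finset.range k, (Polynomial.X - C (a i - 2))) v) := by
  induction k generalizing v with
  | zero => simp
  | succ k ih =>
    rw [Finset.prod_range_succ, Finset.prod_range_succ, map_mul, Module.End.mul_apply, map_mul,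
      Module.End.mul_apply, ← ih]
    congr 1
    simp [h.H_X]
    module

theorem casimir_eigenvalue_injective [CharZero F] :
    Function.Injective fun n : ℕ => ((n : F) * (n + 2)) := by
  intro a b hab
  have : a * (a + 2) = b * (b + 2) := by
    have hab' : (a : F) * (a + 2) = b * (b + 2) := hab
    exact_mod_cast hab'
  rcases lt_trichotomy a b with hlt | rfl | hlt
  · nlinarith
  · rfl
  · nlinarith

variable [CharZero F] [FiniteDimensional F V]

theorem exists_X_pow_eq_zero (h : Sl2Endos X H Y) : ∃ N, X ^ N = 0 := by
  by_contra! hne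
  -- otherwise the powers of `X` are eigenvectors of `[H, ·]` for infinitely many eigenvalues
  have heig : ∀ k : ℕ, H * X ^ k - X ^ k * H = (2 * k : F) • X ^ k := by
    intro k
    induction k with
    | zero => simp
    | succ k ih =>
      ext v
      have h1 := LinearMap.congr_fun ih v
      simp only [LinearMap.sub_apply, Module.End.mul_apply, LinearMap.smul_apply, pow_succ'] at h1 ⊢
      rw [h.H_X, sub_eq_iff_eq_add.1 h1, map_add, map_smul]
      push_cast
      module
  let f : Module.End F (Module.End F V) := LinearMap.mulLeft F H - LinearMap.mulRight F H
  have hli := Module.End.eigenvectors_linearIndependent' f (fun k : ℕ => (2 * k : F))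
    (fun a b hab => by simpa using hab) (fun k => X ^ k)
    (fun k => ⟨Module.End.mem_eigenspace_iff.2 (by simpa [f] using heig k), hne k⟩)
  exact not_finite_iff_infinite.2 inferInstance (hli.finite (R := F))

/-- On `ker X`, the operator `H` is diagonalizable with natural eigenvalues: `X^N Y^N = 0` there, and
`X^N Y^N` is a non-zero multiple of `∏_{j < N} (H - j)`. -/
theorem exists_aeval_H_eq_zero (h : Sl2Endos X H Y) :
    ∃ N : ℕ, ∀ v, X v = 0 →
      aeval H (∏ j ∈ Finset.range N, (Polynomial.X - C (j : F))) v = 0 := by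
  obtain ⟨N, hN⟩ := h.exists_X_pow_eq_zero
  refine ⟨N, fun v hv => ?_⟩
  have := h.X_pow_Y_pow hv N
  rw [hN, LinearMap.zero_apply, eq_comm, smul_eq_zero] at this
  exact this.resolve_left (by exact_mod_cast N.factorial_ne_zero)

theorem eq_zero_of_weight (h : Sl2Endos X H Y) {v : V} (hv : X v = 0) {μ : F}
    (hH : H v = μ • v) (hμ : ∀ n : ℕ, μ ≠ n) : v = 0 := by
  obtain ⟨N, hN⟩ := h.exists_aeval_H_eq_zero
  have := hN v hv
  rw [aeval_apply_eq_eval_smul H _ hH, smul_eq_zero, eval_prod, Finset.prod_eq_zero_iff] at this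
  refine this.resolve_left ?_
  rintro ⟨j, -, hj⟩
  exact hμ j (by simpa [sub_eq_zero] using hj)

/-- On `ker X`, the Casimir operator is diagonalizable with eigenvalues of the form `j(j+2)`. -/
theorem casimir_aeval_of_X_eq_zero (h : Sl2Endos X H Y) :
    ∃ N : ℕ, ∀ v, X v = 0 → aeval (casimir X H Y)
      (∏ j ∈ Finset.range N, (Polynomial.X - C ((j : F) * (j + 2)))) v = 0 := by
  obtain ⟨N, hN⟩ := h.exists_aeval_H_eq_zero
  refine ⟨N, fun v hv => ?_⟩
  have hinv : ∀ w ∈ LinearMap.ker X, H w ∈ LinearMap.ker X := by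
    intro w hw
    rw [LinearMap.mem_ker] at hw ⊢
    have := h.H_X w
    rw [hw] at this
    simpa using this.symm
  refine mem_of_aeval_prod_eq_zero (W := LinearMap.ker X) hinv (LinearMap.ker _)
    (s := Finset.range N) (q := fun j => Polynomial.X - C (j : F)) ?_ ?_ hv (hN v hv)
  · intro i _ j _ hij
    exact isCoprime_X_sub_C_of_isUnit_sub
      (sub_ne_zero.2 (by exact_mod_cast hij)).isUnit
  · intro j hj w hw hjw
    have hHw : H w = (j : F) • w := by simpa [-map_natCast, sub_eq_zero] using hjw
    rw [LinearMap.mem_ker, aeval_apply_eq_eval_smul _ _ (casimir_of_primitive hw hHw), eval_prod,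
      Finset.prod_eq_zero hj (by simp), zero_smul]

/-- All eigenvalues of the Casimir operator are of the form `j(j+2)`: by induction on `k`, a power of
the polynomial that works on `ker X` kills `ker X^k`. -/
theorem exists_casimir_decomposition (h : Sl2Endos X H Y) :
    ∃ N : ℕ, ∀ v, aeval (casimir X H Y)
      (∏ j ∈ Finset.range N, (Polynomial.X - C ((j : F) * (j + 2))) ^ N) v = 0 := by
  obtain ⟨N, hN⟩ := h.casimir_aeval_of_X_eq_zero
  obtain ⟨M, hM⟩ := h.exists_X_pow_eq_zero
  set p : ℕ → F[X] := fun N => ∏ j ∈ Finset.range N, (Polynomial.X - C ((j : F) * (j + 2))) with hp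
  have key : ∀ k v, (X ^ k) v = 0 → aeval (casimir X H Y) (p N ^ k) v = 0 := by
    intro k
    induction k with
    | zero => intro v hv; simpa using hv
    | succ k ih =>
      intro v hv
      have h1 := ih (X v) (by rwa [pow_succ, Module.End.mul_apply] at hv)
      rw [h.aeval_casimir_X] at h1
      rw [pow_succ', map_mul, Module.End.mul_apply]
      exact hN _ h1
  refine ⟨max N M, fun v => ?_⟩
  have hdvd : p N ^ M ∣ ∏ j ∈ Finset.range (max N M),
      (Polynomial.X - C ((j : F) * (j + 2))) ^ (max N M) := by
    rw [Finset.prod_pow]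
    refine (pow_dvd_pow _ (le_max_right N M)).trans (pow_dvd_pow_of_dvd ?_ _)
    exact Finset.prod_dvd_prod_of_subset _ _ _ (by simp)
  obtain ⟨r, hr⟩ := hdvd
  rw [hr, mul_comm, map_mul, Module.End.mul_apply, key M v (by simp [hM]), map_zero]

/-- On the generalized Casimir eigenspace for `n(n+2)`, every vector of `ker X` has weight `n`. -/
theorem weight_of_casimir (h : Sl2Endos X H Y) {n N : ℕ} {v : V} (hv : X v = 0)
    (hΩ : aeval (casimir X H Y) ((Polynomial.X - C ((n : F) * (n + 2))) ^ N) v = 0) :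
    H v = (n : F) • v := by
  obtain ⟨M, hM⟩ := h.casimir_aeval_of_X_eq_zero
  -- the Casimir operator is diagonalizable on `ker X`
  have hΩv : casimir X H Y v = ((n : F) * (n + 2)) • v := by
    have h0 := hM v hv
    refine sub_eq_zero.1 ?_
    refine mem_of_aeval_prod_eq_zero (f := casimir X H Y) (V := V) (W := LinearMap.ker
      (aeval (casimir X H Y) ((Polynomial.X - C ((n : F) * (n + 2))) ^ N))) ?_
      (LinearMap.ker (casimir X H Y - ((n : F) * (n + 2)) • LinearMap.id)) (s := Finset.range M)
      (q := fun j => Polynomial.X - C ((j : F) * (j + 2))) ?_ ?_ hΩ h0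
    · intro w hw
      rw [LinearMap.mem_ker] at hw ⊢
      rw [aeval_apply_of_commute (fun _ => rfl), hw, map_zero]
    · intro i _ j _ hij
      exact isCoprime_X_sub_C_of_isUnit_sub
        (sub_ne_zero.2 (fun he => hij (casimir_eigenvalue_injective he))).isUnit
    · intro j _ w hw hjw
      have hjw' : casimir X H Y w = ((j : F) * (j + 2)) • w := by
        have : casimir X H Y w - ((j : F) * (j + 2)) • w = 0 := by
          simpa [-map_mul, -map_add] using hjw
        exact sub_eq_zero.1 this
      rw [LinearMap.mem_ker, aeval_apply_eq_eval_smul _ _ hjw', smul_eq_zero] at hw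
      rcases hw with hw | rfl
      · have hjn : (j : F) * (j + 2) = n * (n + 2) := by
          rw [eval_pow] at hw
          simpa [-map_mul, -map_add, sub_eq_zero] using eq_zero_of_pow_eq_zero hw
        rw [LinearMap.mem_ker, LinearMap.sub_apply, hjw', hjn]; simp
      · simp
  have hHX : X (H v) = 0 := by
    have := h.H_X v
    rw [hv] at this
    simpa using this.symm
  rw [casimir_apply, hv, map_zero, smul_zero, zero_add] at hΩv
  -- `(H - n) v` is primitive of weight `-(n+2)`, hence zero
  refine sub_eq_zero.1 (h.eq_zero_of_weight (μ := -((n : F) + 2)) ?_ ?_ ?_)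
  · simp [hHX, hv]
  · rw [map_sub, map_smul, eq_sub_of_add_eq hΩv]
    module
  · intro m hm
    have : ((m + n + 2 : ℕ) : F) = 0 := by push_cast; rw [← hm]; ring
    exact absurd (Nat.cast_eq_zero.1 this) (by omega)

/-- On the generalized Casimir eigenspace for `n(n+2)`, the operator `H` is diagonalizable, with
eigenvalues `n - 2i`. -/
theorem aeval_H_of_casimir (h : Sl2Endos X H Y) {n N : ℕ} (k : ℕ) {v : V} (hv : (X ^ k) v = 0)
    (hΩ : aeval (casimir X H Y) ((Polynomial.X - C ((n : F) * (n + 2))) ^ N) v = 0) :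
    aeval H (∏ i ∈ Finset.range k, (Polynomial.X - C ((n : F) - 2 * i))) v = 0 := by
  induction k generalizing v with
  | zero => simpa using hv
  | succ k ih =>
    have h1 := ih (v := X v) (by rwa [pow_succ, Module.End.mul_apply] at hv)
      (by rw [h.aeval_casimir_X, hΩ, map_zero])
    rw [h.aeval_H_X] at h1
    have hcomm : ∀ q : F[X], aeval (casimir X H Y) ((Polynomial.X - C ((n : F) * (n + 2))) ^ N)
        (aeval H q v) = 0 := fun q => by
      refine aeval_apply_mem_of_invariant (W := LinearMap.ker (aeval (casimir X H Y)
        ((Polynomial.X - C ((n : F) * (n + 2))) ^ N))) (fun w hw => ?_) q hΩ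
      rw [LinearMap.mem_ker] at hw ⊢
      rw [aeval_apply_of_commute h.casimir_H, hw, map_zero]
    have h2 := h.weight_of_casimir h1 (hcomm _)
    rw [Finset.prod_range_succ', mul_comm, map_mul, Module.End.mul_apply]
    have : ∀ i : ℕ, (n : F) - 2 * ((i + 1 : ℕ) : F) = n - 2 * i - 2 := by intro i; push_cast; ring
    simp only [this]
    simpa [-map_natCast, sub_eq_zero] using h2

/-- A vector of weight `n - 2i` in the generalized Casimir eigenspace for `n(n+2)` is of the form
`Y^i p` with `p` primitive of weight `n`, and `i ≤ n` or it vanishes. -/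
theorem exists_eq_pow_Y (h : Sl2Endos X H Y) {n N : ℕ} (i : ℕ) {v : V}
    (hH : H v = ((n : F) - 2 * i) • v)
    (hΩ : aeval (casimir X H Y) ((Polynomial.X - C ((n : F) * (n + 2))) ^ N) v = 0) :
    (n < i → v = 0) ∧ ∃ p, X p = 0 ∧ H p = (n : F) • p ∧ v = (Y ^ i) p := by
  have hlow : n < i → v = 0 := by
    intro hlt
    -- for the opposite triple `(Y, -H, X)`, the eigenvalues of `-H` are also of the form `n - 2j`
    obtain ⟨M, hM⟩ := h.symm.exists_X_pow_eq_zero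
    have h1 := h.symm.aeval_H_of_casimir (n := n) (N := N) M (v := v) (by simp [hM])
      (by rwa [h.casimir_symm])
    rw [aeval_apply_eq_eval_smul (-H) _ (μ := -((n : F) - 2 * i)) (by simp [hH, ← neg_smul]), smul_eq_zero,
      eval_prod, Finset.prod_eq_zero_iff] at h1
    refine h1.resolve_left ?_
    rintro ⟨j, -, hj⟩
    have h2 : (2 : F) * ((i : F) + j - n) = 0 := by
      rw [← hj]; simp; ring
    have h3 : ((i + j : ℕ) : F) = (n : ℕ) := by
      push_cast
      exact sub_eq_zero.1 ((mul_eq_zero.1 h2).resolve_left two_ne_zero)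
    have := Nat.cast_injective h3
    omega
  refine ⟨hlow, ?_⟩
  have hΩX : aeval (casimir X H Y) ((Polynomial.X - C ((n : F) * (n + 2))) ^ N) (X v) = 0 := by
    rw [h.aeval_casimir_X, hΩ, map_zero]
  induction i generalizing v with
  | zero =>
    refine ⟨v, ?_, by simpa using hH, by simp⟩
    obtain ⟨M, hM⟩ := h.exists_X_pow_eq_zero
    have h1 := h.aeval_H_of_casimir (n := n) (N := N) M (v := X v) (by simp [hM]) hΩX
    rw [aeval_apply_eq_eval_smul H _ (μ := (n : F) + 2) (by rw [h.H_X, hH, map_smul]; simp; module),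
      smul_eq_zero, eval_prod, Finset.prod_eq_zero_iff] at h1
    refine h1.resolve_left ?_
    rintro ⟨j, -, hj⟩
    have h2 : (2 : F) * ((j + 1 : ℕ) : F) = 0 := by
      rw [← hj]; simp; ring
    rw [mul_eq_zero, Nat.cast_eq_zero] at h2
    exact h2.elim two_ne_zero (Nat.succ_ne_zero j)
  | succ i ih =>
    rcases lt_or_ge n (i + 1) with hlt | hle
    · exact ⟨0, by simp, by simp, by simp [hlow hlt]⟩
    have hHX : H (X v) = ((n : F) - 2 * i) • X v := by
      rw [h.H_X, hH, map_smul]; push_cast; module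
    obtain ⟨p, hp, hHp, hXv⟩ := ih hHX hΩX (by omega) (by rw [h.aeval_casimir_X, hΩX, map_zero])
    have hni : (n : F) - i ≠ 0 := sub_ne_zero.2 (by exact_mod_cast (by omega : n ≠ i))
    have hi : (i : F) + 1 ≠ 0 := Nat.cast_add_one_ne_zero i
    -- `v - c Y^{i+1} p` lies in `ker X` and has weight `n - 2(i+1)`, not `n`, so it vanishes
    set c : F := ((i + 1) * ((n : F) - i))⁻¹ with hc
    refine ⟨c • p, by simp [hp], by rw [map_smul, hHp, smul_comm], ?_⟩
    rw [map_smul, ← sub_eq_zero]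
    have hX0 : X (v - c • (Y ^ (i + 1)) p) = 0 := by
      rw [map_sub, map_smul, h.X_pow_succ_Y_of_weight hp hHp, smul_smul, hc,
        inv_mul_cancel₀ (mul_ne_zero hi hni), hXv]
      simp
    have hH0 : H (v - c • (Y ^ (i + 1)) p) =
        ((n : F) - 2 * (i + 1 : ℕ)) • (v - c • (Y ^ (i + 1)) p) := by
      rw [map_sub, map_smul, hH, h.H_pow_Y hHp]; module
    have hΩp := h.casimir_pow_Y (casimir_of_primitive hp hHp) (i + 1)
    have hΩ0 : aeval (casimir X H Y) ((Polynomial.X - C ((n : F) * (n + 2))) ^ (N + 1))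
        (v - c • (Y ^ (i + 1)) p) = 0 := by
      rw [map_sub, map_smul, aeval_apply_eq_eval_smul _ _ hΩp, pow_succ', map_mul,
        Module.End.mul_apply, hΩ]
      simp
    have hH1 := h.weight_of_casimir hX0 hΩ0
    rw [hH0, ← sub_eq_zero, ← sub_smul, smul_eq_zero] at hH1
    refine hH1.resolve_left ?_
    have : ((i + 1 : ℕ) : F) ≠ 0 := Nat.cast_ne_zero.2 (Nat.succ_ne_zero i)
    simpa using this

/-- Complete reducibility, in the form that `V` is spanned by the vectors `Y^i v` with `v` primitive
of some weight `n` and `i ≤ n`. -/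
theorem eq_top_of_pow_Y_mem (h : Sl2Endos X H Y) (U : Submodule F V)
    (hU : ∀ (n i : ℕ) (v : V), i ≤ n → X v = 0 → H v = (n : F) • v → (Y ^ i) v ∈ U) : U = ⊤ := by
  obtain ⟨N, hN⟩ := h.exists_casimir_decomposition
  obtain ⟨M, hM⟩ := h.exists_X_pow_eq_zero
  refine eq_top_iff.2 fun v _ => ?_
  refine mem_of_aeval_prod_eq_zero (f := casimir X H Y) (W := ⊤) (by simp) U ?_ ?_
    (Submodule.mem_top) (hN v)
  · intro i _ j _ hij
    exact (isCoprime_X_sub_C_of_isUnit_sub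
      (sub_ne_zero.2 (fun he => hij (casimir_eigenvalue_injective he))).isUnit).pow
  · intro n _ w _ hw
    refine mem_of_aeval_prod_eq_zero (f := H) (W := LinearMap.ker (aeval (casimir X H Y)
      ((Polynomial.X - C ((n : F) * (n + 2))) ^ N))) ?_ U ?_ ?_ hw
      (h.aeval_H_of_casimir M (by simp [hM]) hw)
    · intro w hw
      rw [LinearMap.mem_ker] at hw ⊢
      rw [aeval_apply_of_commute h.casimir_H, hw, map_zero]
    · intro i _ j _ hij
      refine isCoprime_X_sub_C_of_isUnit_sub (IsUnit.mk0 _ ?_)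
      simpa [sub_eq_zero] using fun he => hij he.symm
    · intro i _ u hu hHu
      have hHu' : H u = ((n : F) - 2 * i) • u := by
        have : H u - ((n : F) - 2 * i) • u = 0 := by
          simpa [-map_mul, -map_sub, -map_add] using hHu
        exact sub_eq_zero.1 this
      obtain ⟨h0, p, hp, hHp, rfl⟩ := h.exists_eq_pow_Y i hHu' hu
      rcases lt_or_ge n i with hlt | hle
      · rw [h0 hlt]; exact U.zero_mem
      · exact hU n i p hle hp hHp

end Sl2Endos

end

/-! ### Independence and irreducibility of strings -/

theorem eq_zero_of_sum_eigenvectors_eq_zero {F V ι : Type*} [Field F] [AddCommGroup V] [Module F V]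
    [Fintype ι] (f : Module.End F V) {μ : ι → F} (hμ : Function.Injective μ) {v : ι → V}
    (hv : ∀ i, f (v i) = μ i • v i) (h : ∑ i, v i = 0) (i : ι) : v i = 0 :=
  (iSupIndep_iff_finsetSum_eq_zero_imp_eq_zero _).1 (f.eigenspaces_iSupIndep.comp hμ) Finset.univ v
    (fun i _ => Module.End.mem_eigenspace_iff.2 (hv i)) h i (Finset.mem_univ i)

namespace Sl2Endos

variable {F V : Type*} [Field F] [AddCommGroup V] [Module F V] {X H Y : Module.End F V}

/-- The span of `v, Y v, …, Yⁿ v`; when `v` is primitive of weight `n`, this is the submodule that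
`v` generates. -/
def string (Y : Module.End F V) (n : ℕ) (v : V) : Submodule F V :=
  Submodule.span F (Set.range fun i : Fin (n + 1) => (Y ^ (i : ℕ)) v)

theorem pow_Y_mem_string {n i : ℕ} (hi : i ≤ n) (v : V) : (Y ^ i) v ∈ string Y n v :=
  Submodule.subset_span ⟨⟨i, by omega⟩, rfl⟩

variable [CharZero F]

theorem pow_Y_ne_zero (h : Sl2Endos X H Y) {n : ℕ} {v : V} (hv : X v = 0)
    (hH : H v = (n : F) • v) (h0 : v ≠ 0) {i : ℕ} (hi : i ≤ n) : (Y ^ i) v ≠ 0 := by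
  induction i with
  | zero => simpa
  | succ i ih =>
    intro h1
    have h2 := h.X_pow_succ_Y_of_weight hv hH i
    rw [h1, map_zero, eq_comm, smul_eq_zero] at h2
    refine h2.elim (mul_ne_zero (Nat.cast_add_one_ne_zero i) ?_) (ih (by omega))
    exact sub_ne_zero.2 (by exact_mod_cast (by omega : n ≠ i))

theorem linearIndependent_pow_Y (h : Sl2Endos X H Y) {n : ℕ} {v : V} (hv : X v = 0)
    (hH : H v = (n : F) • v) (h0 : v ≠ 0) :
    LinearIndependent F fun i : Fin (n + 1) => (Y ^ (i : ℕ)) v :=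
  Module.End.eigenvectors_linearIndependent' H (fun i : Fin (n + 1) => (n : F) - 2 * i)
    (fun a b hab => by
      have : (a : ℕ) = b := by simpa using hab
      exact Fin.ext this) _
    fun i => ⟨Module.End.mem_eigenspace_iff.2 (h.H_pow_Y hH i),
      h.pow_Y_ne_zero hv hH h0 (Nat.lt_succ_iff.1 i.2)⟩

/-- The vectors `Y^i p` with `p` primitive of weight `n` and `i < n` are independent: they are
joint eigenvectors of the Casimir operator and of `H`, with distinct pairs of eigenvalues. -/
theorem eq_zero_of_sum_pow_Y_eq_zero (h : Sl2Endos X H Y) {ι : Type*} [Fintype ι] {t : ι → ℕ}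
    (ht : Function.Injective t) {p : ∀ j, Fin (t j) → V} (hX : ∀ j i, X (p j i) = 0)
    (hH : ∀ j i, H (p j i) = (t j : F) • p j i)
    (hsum : ∑ j, ∑ i : Fin (t j), (Y ^ (i : ℕ)) (p j i) = 0) (j : ι) (i : Fin (t j)) :
    p j i = 0 := by
  have h1 := eq_zero_of_sum_eigenvectors_eq_zero (casimir X H Y)
    (casimir_eigenvalue_injective.comp ht)
    (fun j => by
      rw [map_sum, Finset.smul_sum]
      exact Finset.sum_congr rfl fun i _ =>
        h.casimir_pow_Y (casimir_of_primitive (hX j i) (hH j i)) i) hsum j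
  have h2 := eq_zero_of_sum_eigenvectors_eq_zero H (μ := fun i : Fin (t j) => (t j : F) - 2 * i)
    (fun a b hab => by
      have : (a : ℕ) = b := by simpa using hab
      exact Fin.ext this)
    (fun i => h.H_pow_Y (hH j i) i) h1 i
  by_contra hne
  exact h.pow_Y_ne_zero (hX j i) (hH j i) hne i.2.le h2

variable [FiniteDimensional F V]

theorem pow_succ_Y_eq_zero (h : Sl2Endos X H Y) {n : ℕ} {v : V} (hv : X v = 0)
    (hH : H v = (n : F) • v) : (Y ^ (n + 1)) v = 0 := by
  refine h.eq_zero_of_weight (by rw [h.X_pow_succ_Y_of_weight hv hH]; simp) (h.H_pow_Y hH _) ?_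
  intro m hm
  have : ((m + n + 2 : ℕ) : F) = 0 := by push_cast at hm ⊢; rw [← hm]; ring
  exact absurd (Nat.cast_eq_zero.1 this) (by omega)

theorem string_stable (h : Sl2Endos X H Y) {n : ℕ} {v : V} (hv : X v = 0)
    (hH : H v = (n : F) • v) {w : V} (hw : w ∈ string Y n v) :
    X w ∈ string Y n v ∧ H w ∈ string Y n v ∧ Y w ∈ string Y n v := by
  induction hw using Submodule.span_induction with
  | zero => simp
  | add x y _ _ hx hy =>
    simp only [map_add]
    exact ⟨add_mem hx.1 hy.1, add_mem hx.2.1 hy.2.1, add_mem hx.2.2 hy.2.2⟩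
  | smul a x _ hx =>
    simp only [map_smul]
    exact ⟨Submodule.smul_mem _ _ hx.1, Submodule.smul_mem _ _ hx.2.1,
      Submodule.smul_mem _ _ hx.2.2⟩
  | mem x hx =>
    obtain ⟨⟨i, hi⟩, rfl⟩ := hx
    refine ⟨?_, ?_, ?_⟩
    · cases i with
      | zero => simp [hv]
      | succ i =>
        simp only [h.X_pow_succ_Y_of_weight hv hH]
        exact Submodule.smul_mem _ _ (pow_Y_mem_string (by omega) v)
    · simp only [h.H_pow_Y hH]
      exact Submodule.smul_mem _ _ (pow_Y_mem_string (by omega) v)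
    · change Y ((Y ^ i) v) ∈ _
      rw [← Module.End.mul_apply, ← pow_succ']
      rcases (Nat.lt_succ_iff.1 hi).lt_or_eq with hlt | rfl
      · exact pow_Y_mem_string hlt v
      · rw [h.pow_succ_Y_eq_zero hv hH]; exact zero_mem _

/-- The string of a primitive vector `v` is irreducible, since every vector of it killed by `X` is a
multiple of `v`. -/
theorem string_irreducible (h : Sl2Endos X H Y) {n : ℕ} {v : V} (hv : X v = 0)
    (hH : H v = (n : F) • v) (h0 : v ≠ 0) {U : Submodule F V} (hU : U ≤ string Y n v)
    (hUX : ∀ u ∈ U, X u ∈ U) (hUY : ∀ u ∈ U, Y u ∈ U) : U = ⊥ ∨ U = string Y n v := by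
  refine or_iff_not_imp_left.2 fun hne => le_antisymm hU ?_
  obtain ⟨u, hu, hu0⟩ := Submodule.exists_mem_ne_zero_of_ne_bot hne
  obtain ⟨N, hN⟩ := h.exists_X_pow_eq_zero
  -- the last non-zero vector among the `X^k u`
  obtain ⟨k, hk, hk'⟩ := Nat.exists_not_and_succ_of_not_zero_of_exists
    (p := fun k => (X ^ k) u = 0) (by simpa) ⟨N, by simp [hN]⟩
  have hpow : ∀ (Z : Module.End F V), (∀ u ∈ U, Z u ∈ U) → ∀ (k : ℕ) (u), u ∈ U →
      (Z ^ k) u ∈ U := by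
    intro Z hZ k
    induction k with
    | zero => simp
    | succ k ih => intro u hu; rw [pow_succ]; exact ih _ (hZ u hu)
  set w := (X ^ k) u
  have hwU : w ∈ U := hpow X hUX k u hu
  have hXw : X w = 0 := by rwa [pow_succ'] at hk'
  obtain ⟨c, hc⟩ := (Submodule.mem_span_range_iff_exists_fun F).1 (hU hwU)
  have hXc : ∑ i : Fin n, (c i.succ * ((i + 1) * ((n : F) - i))) • (Y ^ (i : ℕ)) v = 0 := by
    rw [← hXw, ← hc, map_sum, Fin.sum_univ_succ]
    simp [hv, h.X_pow_succ_Y_of_weight hv hH, smul_smul]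
  have hc0 : ∀ i : Fin n, c i.succ = 0 := by
    intro i
    have := Fintype.linearIndependent_iff.1 ((h.linearIndependent_pow_Y hv hH h0).comp _
      (Fin.castSucc_injective n)) _ hXc i
    refine (mul_eq_zero.1 this).resolve_right (mul_ne_zero (Nat.cast_add_one_ne_zero _) ?_)
    exact sub_ne_zero.2 (by exact_mod_cast i.2.ne')
  have hwv : w = c 0 • v := by
    rw [← hc, Fin.sum_univ_succ]
    simp [hc0]
  have hvU : v ∈ U := by
    have hc00 : c 0 ≠ 0 := by
      intro h00
      exact hk (by rw [hwv, h00, zero_smul])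
    rw [hwv] at hwU
    exact (Submodule.smul_mem_iff _ hc00).1 hwU
  refine Submodule.span_le.2 ?_
  rintro _ ⟨i, rfl⟩
  exact hpow Y hUY i v hvU

end Sl2Endos

/-! ### Invariant forms on `S_m` -/

theorem stdY_mulVec_single {F : Type*} [Field F] {m i : ℕ} (hi : i + 1 < m) :
    stdY F m *ᵥ Pi.single (⟨i, by omega⟩ : Fin m) 1 = Pi.single ⟨i + 1, hi⟩ 1 := by
  ext k
  simp [stdY, Pi.single_apply, Fin.ext_iff]

theorem stdY_pow_mulVec_single {F : Type*} [Field F] (n : ℕ) :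
    (stdY F (n + 1) ^ n) *ᵥ Pi.single 0 1 = Pi.single (Fin.last n) 1 := by
  have : ∀ k (hk : k ≤ n), (stdY F (n + 1) ^ k) *ᵥ Pi.single 0 1 =
      Pi.single (⟨k, by omega⟩ : Fin (n + 1)) 1 := by
    intro k
    induction k with
    | zero => intro _; rw [pow_zero, Matrix.one_mulVec]; rfl
    | succ k ih =>
      intro hk
      rw [pow_succ', ← Matrix.mulVec_mulVec, ih (by omega), stdY_mulVec_single (by omega)]
  exact this n le_rfl

theorem stdH_mulVec_single {F : Type*} [Field F] {m : ℕ} (i : Fin m) :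
    stdH F m *ᵥ Pi.single i 1 = ((m : F) - 1 - 2 * (i : ℕ)) • Pi.single i 1 := by
  ext k
  by_cases h : k = i
  · subst h; simp [stdH]
  · simp [stdH, h]

/-- An invariant form on `S_{n+1}` pairs the basis vectors `e_i` and `e_{n-i}` only. -/
theorem IsInvariantForm.apply_single {F : Type*} [Field F] [CharZero F] {n : ℕ}
    {β : LinearMap.BilinForm F (Fin (n + 1) → F)} (hβ : IsInvariantForm β) (i k : Fin (n + 1)) :
    β (Pi.single i 1) (Pi.single k 1) =
      if (i : ℕ) + k = n then (-1) ^ (i : ℕ) * normConst n β else 0 := by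
  split_ifs with h
  · obtain ⟨i, hi⟩ := i
    induction i generalizing k with
    | zero =>
      have : k = Fin.last n := Fin.ext (by simpa using h)
      subst this
      rw [normConst, stdY_pow_mulVec_single]
      simp
    | succ i ih =>
      simp only at h
      have h1 := hβ.inv_Y (Pi.single ⟨i, by omega⟩ 1) (Pi.single k 1)
      have hk : stdY F (n + 1) *ᵥ Pi.single k 1 = Pi.single ⟨k + 1, by omega⟩ 1 :=
        stdY_mulVec_single (i := k) (by omega)
      rw [stdY_mulVec_single hi, hk,
        ih ⟨k + 1, by omega⟩ (by omega) (by simp; omega)] at h1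
      rw [pow_succ, eq_neg_of_add_eq_zero_left h1]
      ring
  · have h1 := hβ.inv_H (Pi.single i 1) (Pi.single k 1)
    simp only [stdH_mulVec_single, map_smul, LinearMap.smul_apply, ← add_smul] at h1
    rw [smul_eq_zero] at h1
    refine h1.resolve_left fun h2 => h ?_
    have h3 : (2 : F) * ((n : F) - (i + k : ℕ)) = 0 := by
      rw [← h2]; push_cast; ring
    exact_mod_cast (sub_eq_zero.1 ((mul_eq_zero.1 h3).resolve_left two_ne_zero)).symm

theorem IsInvariantForm.normConst_ne_zero {F : Type*} [Field F] [CharZero F] {n : ℕ}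
    {β : LinearMap.BilinForm F (Fin (n + 1) → F)} (hβ : IsInvariantForm β) :
    normConst n β ≠ 0 := by
  intro h0
  have hβ0 : β = 0 := by
    refine LinearMap.ext_basis (Pi.basisFun F _) (Pi.basisFun F _) fun i k => ?_
    simp [hβ.apply_single, h0]
  have := hβ.nondeg.1 (Pi.single 0 1) (by simp [hβ0])
  simpa using congrFun this 0

/-- The compatible normalization expresses the form on `S_n` through the constant of the form on
`S_{n+1}`, up to the square of a scalar `c`. -/
theorem exists_scaling {F : Type*} [Field F] [CharZero F]
    {β : ∀ m : ℕ, LinearMap.BilinForm F (Fin m → F)} (hβ : ∀ m, 1 ≤ m → IsInvariantForm (β m))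
    (hnorm : ∀ n, IsSquare (normConst n (β (n + 1)) / normConst (n + 1) (β (n + 2))))
    {n : ℕ} (hn : 1 ≤ n) :
    ∃ c : F, c ≠ 0 ∧ ∀ i k : Fin n, β n (Pi.single i 1) (Pi.single k 1) =
      if (i : ℕ) + k + 1 = n then (-1) ^ (i : ℕ) * (c * c * normConst n (β (n + 1))) else 0 := by
  obtain ⟨m, rfl⟩ := Nat.exists_eq_add_of_le' hn
  obtain ⟨c, hc⟩ := hnorm m
  have h1 := (hβ (m + 1) (by omega)).normConst_ne_zero
  have h2 := (hβ (m + 2) (by omega)).normConst_ne_zero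
  refine ⟨c, ?_, fun i k => ?_⟩
  · rintro rfl
    rw [mul_zero] at hc
    exact div_ne_zero h1 h2 hc
  · rw [← hc, div_mul_cancel₀ _ h2, (hβ (m + 1) (by omega)).apply_single]
    simp

/-! ### Coordinates on `M ⊗ Fⁿ` -/

/-- `M ⊗ Fⁿ ≅ Mⁿ`, linearly over a not necessarily commutative algebra acting on `M`. -/
noncomputable def tensorCoords (F A M : Type*) [Field F] [Ring A] [Algebra F A] [AddCommGroup M]
    [Module F M] [Module A M] [IsScalarTower F A M] (n : ℕ) :
    M ⊗[F] (Fin n → F) ≃ₗ[A] (Fin n → M) where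
  __ := TensorProduct.piScalarRight F F M (Fin n)
  map_smul' a x := by
    induction x with
    | zero => simp
    | add x y hx hy =>
      simp only [smul_add, AddHom.toFun_eq_coe, LinearMap.coe_toAddHom, LinearEquiv.coe_coe,
        map_add, RingHom.id_apply] at hx hy ⊢
      rw [hx, hy]
    | tmul m s =>
      ext i
      simp [TensorProduct.smul_tmul', TensorProduct.piScalarRight_apply, smul_comm a (s i) m]

theorem tensorCoords_symm_apply (F A M : Type*) [Field F] [Ring A] [Algebra F A] [AddCommGroup M]
    [Module F M] [Module A M] [IsScalarTower F A M] (n : ℕ) (x : Fin n → M) :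
    (tensorCoords F A M n).symm x = ∑ i, x i ⊗ₜ[F] Pi.single i 1 := by
  conv_lhs => rw [← Finset.univ_sum_single x]
  rw [map_sum]
  exact Finset.sum_congr rfl fun i _ => TensorProduct.piScalarRight_symm_single F F M (Fin n) (x i) i

theorem tensorForm_eq_sum {F D A M : Type*} [Field F] [DivisionRing D] [Algebra F D] [Ring A]
    [Algebra F A] [AddCommGroup M] [Module F M] [Module A M] [IsScalarTower F A M] {n : ℕ}
    (C : M →ₗ[F] M →ₗ[F] D) (β : LinearMap.BilinForm F (Fin n → F))
    (x y : M ⊗[F] (Fin n → F)) :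
    tensorForm C β x y = ∑ i, ∑ k, β (Pi.single i 1) (Pi.single k 1) •
      C (tensorCoords F A M n x i) (tensorCoords F A M n y k) := by
  obtain ⟨x, rfl⟩ := (tensorCoords F A M n).symm.surjective x
  obtain ⟨y, rfl⟩ := (tensorCoords F A M n).symm.surjective y
  rw [LinearEquiv.apply_symm_apply, LinearEquiv.apply_symm_apply, tensorCoords_symm_apply,
    tensorCoords_symm_apply]
  simp only [tensorForm, map_sum, LinearMap.sum_apply, LinearMap.compr₂_apply,
    TensorProduct.map₂_apply_tmul, LinearEquiv.coe_coe]
  exact Finset.sum_comm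

/-! ### Multiplicity spaces of an `𝔰𝔩₂`-triple -/

theorem LinearMap.restrictScalars_pow_apply {F A V : Type*} [Field F] [Ring A] [Algebra F A]
    [AddCommGroup V] [Module F V] [Module A V] [IsScalarTower F A V] (f : Module.End A V) (k : ℕ)
    (v : V) : ((f.restrictScalars F) ^ k : Module.End F V) v = (f ^ k) v := by
  induction k with
  | zero => rfl
  | succ k ih => rw [pow_succ', pow_succ', Module.End.mul_apply, Module.End.mul_apply, ih]; rfl

namespace EpsHermitianForm

variable {F D : Type*} [Field F] [DivisionRing D] [Algebra F D] [StarRing D] {ε : ℤˣ}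
  {V : Type*} [AddCommGroup V] [Module F V] [Module Dᵐᵒᵖ V] [IsScalarTower F Dᵐᵒᵖ V]
  {B : EpsHermitianForm F D ε V}

theorem finiteDimensional_of_finite (F D : Type*) [Field F] [DivisionRing D] [Algebra F D]
    [FiniteDimensional F D] (V : Type*) [AddCommGroup V] [Module F V] [Module Dᵐᵒᵖ V]
    [IsScalarTower F Dᵐᵒᵖ V] [Module.Finite Dᵐᵒᵖ V] : FiniteDimensional F V :=
  have : FiniteDimensional F Dᵐᵒᵖ :=
    Module.Finite.equiv (MulOpposite.opLinearEquiv F : D ≃ₗ[F] Dᵐᵒᵖ)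
  Module.Finite.trans Dᵐᵒᵖ V

theorem form_apply_left_of_mem {X : Module.End Dᵐᵒᵖ V} (hX : X ∈ B.lieAlgebra) (u v : V) :
    B.form (X u) v = -B.form u (X v) :=
  eq_neg_of_add_eq_zero_left (hX u v)

theorem form_pow_apply_left_of_mem {X : Module.End Dᵐᵒᵖ V} (hX : X ∈ B.lieAlgebra) (k : ℕ)
    (u v : V) : B.form ((X ^ k) u) v = (-1 : F) ^ k • B.form u ((X ^ k) v) := by
  induction k generalizing v with
  | zero => simp
  | succ k ih =>
    rw [pow_succ', Module.End.mul_apply, form_apply_left_of_mem hX, ih, ← pow_succ', pow_succ X,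
      Module.End.mul_apply, pow_succ', mul_smul]
    simp

namespace Sl2Triple

theorem sl2Endos (γ : Sl2Triple B) :
    Sl2Endos (γ.X.1.restrictScalars F) (γ.H.1.restrictScalars F) (γ.Y.1.restrictScalars F) where
  H_X v := by
    have := LinearMap.congr_fun γ.lie_H_X v
    simp only [Ring.lie_def, LinearMap.sub_apply, Module.End.mul_apply, LinearMap.smul_apply,
      sub_eq_iff_eq_add'] at this
    simp only [LinearMap.restrictScalars_apply, this, two_smul]
  H_Y v := by
    have := LinearMap.congr_fun γ.lie_H_Y v
    simp only [Ring.lie_def, LinearMap.sub_apply, Module.End.mul_apply, LinearMap.smul_apply,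
      LinearMap.neg_apply, sub_eq_iff_eq_add'] at this
    simp only [LinearMap.restrictScalars_apply, this, two_smul, sub_eq_add_neg]
  X_Y v := by
    have := LinearMap.congr_fun γ.lie_X_Y v
    simp only [Ring.lie_def, LinearMap.sub_apply, Module.End.mul_apply,
      sub_eq_iff_eq_add'] at this
    simp only [LinearMap.restrictScalars_apply, this]

theorem X_apply_of_mem_mult {γ : Sl2Triple B} {n : ℕ} {v : V} (hv : v ∈ γ.mult n) :
    γ.X.1 v = 0 := hv.1.2

theorem H_apply_of_mem_mult {γ : Sl2Triple B} {n : ℕ} {v : V} (hv : v ∈ γ.mult n) :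
    γ.H.1 v = (n : F) • v := by
  have h := hv.2
  rw [SetLike.mem_coe, LinearMap.mem_ker, LinearMap.sub_apply, sub_eq_zero] at h
  rw [h, Module.End.natCast_apply, Nat.cast_smul_eq_nsmul]

theorem X_pow_succ_Y_apply {γ : Sl2Triple B} {n : ℕ} {v : V} (hv : v ∈ γ.mult n) (i : ℕ) :
    γ.X.1 ((γ.Y.1 ^ (i + 1)) v) = ((i + 1 : F) * (n - i)) • (γ.Y.1 ^ i) v := by
  have := γ.sl2Endos.X_pow_succ_Y_of_weight (X_apply_of_mem_mult hv) (H_apply_of_mem_mult hv) i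
  simpa only [LinearMap.restrictScalars_pow_apply, LinearMap.restrictScalars_apply] using this

theorem form_pow_Y_of_add_eq {γ : Sl2Triple B} {n : ℕ} (v w : V) {a b : ℕ}
    (h : a + b = n) : B.form ((γ.Y.1 ^ a) v) ((γ.Y.1 ^ b) w) =
      (-1 : F) ^ a • B.form v ((γ.Y.1 ^ n) w) := by
  rw [form_pow_apply_left_of_mem γ.Y.2, ← Module.End.mul_apply, ← pow_add, h]

variable [CharZero F]

/-- Distinct multiplicity spaces generate orthogonal subspaces, because the Casimir operator is
self-adjoint, and `H`, being skew-adjoint, pairs opposite weights only. -/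
theorem form_pow_Y_eq_zero {γ : Sl2Triple B} {n m : ℕ} {v w : V} (hv : v ∈ γ.mult n)
    (hw : w ∈ γ.mult m) {a b : ℕ} (h : n = m → a + b ≠ n) :
    B.form ((γ.Y.1 ^ a) v) ((γ.Y.1 ^ b) w) = 0 := by
  have hX := form_apply_left_of_mem γ.X.2
  have hH := form_apply_left_of_mem γ.H.2
  have hY := form_apply_left_of_mem γ.Y.2
  have hγ := γ.sl2Endos
  have hXv := X_apply_of_mem_mult hv
  have hHv := H_apply_of_mem_mult hv
  have hXw := X_apply_of_mem_mult hw
  have hHw := H_apply_of_mem_mult hw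
  by_contra hne
  have h1 := hγ.casimir_pow_Y (Sl2Endos.casimir_of_primitive hXv hHv) a
  have h2 := hγ.casimir_pow_Y (Sl2Endos.casimir_of_primitive hXw hHw) b
  have h3 := hγ.H_pow_Y hHv a
  have h4 := hγ.H_pow_Y hHw b
  simp only [LinearMap.restrictScalars_pow_apply, LinearMap.restrictScalars_apply] at h1 h2 h3 h4
  have hcas : ∀ p q : V, B.form (Sl2Endos.casimir (γ.X.1.restrictScalars F)
      (γ.H.1.restrictScalars F) (γ.Y.1.restrictScalars F) p) q =
      B.form p (Sl2Endos.casimir (γ.X.1.restrictScalars F)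
      (γ.H.1.restrictScalars F) (γ.Y.1.restrictScalars F) q) := by
    intro p q
    have hXY := hγ.X_Y q
    simp only [LinearMap.restrictScalars_apply] at hXY
    simp only [Sl2Endos.casimir_apply, LinearMap.restrictScalars_apply, map_add, map_smul,
      LinearMap.add_apply, LinearMap.smul_apply, hX, hY, hH, hXY, smul_neg, neg_neg, smul_add]
    module
  have hn : n = m := by
    have h5 := hcas ((γ.Y.1 ^ a) v) ((γ.Y.1 ^ b) w)
    rw [h1, h2, map_smul, map_smul, LinearMap.smul_apply, ← sub_eq_zero, ← sub_smul,
      smul_eq_zero, or_iff_left hne, sub_eq_zero] at h5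
    exact Sl2Endos.casimir_eigenvalue_injective h5
  subst hn
  have h6 := hH ((γ.Y.1 ^ a) v) ((γ.Y.1 ^ b) w)
  rw [h3, h4, map_smul, map_smul, LinearMap.smul_apply, ← sub_eq_zero, sub_neg_eq_add, ← add_smul,
    smul_eq_zero, or_iff_left hne] at h6
  have h7 : (2 : F) * ((n : F) - (a + b : ℕ)) = 0 := by
    rw [← h6]; push_cast; ring
  exact h rfl (by exact_mod_cast (sub_eq_zero.1 ((mul_eq_zero.1 h7).resolve_left two_ne_zero)).symm)

variable [FiniteDimensional F D] [Module.Finite Dᵐᵒᵖ V]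

/-- A primitive vector of weight `n` generates an irreducible module of dimension `n + 1`, so it
lies in the isotypic component. -/
theorem mem_mult_of_primitive (γ : Sl2Triple B) {n : ℕ} {v : V} (hX : γ.X.1 v = 0)
    (hH : γ.H.1 v = (n : F) • v) : v ∈ γ.mult n := by
  have := finiteDimensional_of_finite F D V
  refine ⟨⟨?_, hX⟩, ?_⟩
  · by_cases h0 : v = 0
    · rw [h0]; exact zero_mem _
    have hγ := γ.sl2Endos
    set W := Sl2Endos.string (γ.Y.1.restrictScalars F) n v
    have hvW : v ∈ W := Sl2Endos.pow_Y_mem_string (Nat.zero_le n) v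
    refine Submodule.subset_span ⟨W, ⟨fun w hw => hγ.string_stable hX hH hw, ?_, ?_⟩, ?_, hvW⟩
    · intro hbot
      exact h0 (by simpa [hbot] using hvW)
    · exact fun U hU hUs => hγ.string_irreducible hX hH h0 hU (fun u hu => (hUs u hu).1)
        (fun u hu => (hUs u hu).2.2)
    · simpa using! finrank_span_eq_card (hγ.linearIndependent_pow_Y hX hH h0)
  · rw [SetLike.mem_coe, LinearMap.mem_ker, LinearMap.sub_apply, hH, Module.End.natCast_apply,
      Nat.cast_smul_eq_nsmul, sub_self]

end Sl2Triple

end EpsHermitianForm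

/-! ### The image of the moment map -/

namespace EpsHermitianForm

variable {F D : Type*} [Field F] [DivisionRing D] [Algebra F D] [StarRing D] {ε : ℤˣ}
  {V : Type*} [AddCommGroup V] [Module F V] [Module Dᵐᵒᵖ V] [IsScalarTower F Dᵐᵒᵖ V]
  {V' : Type*} [AddCommGroup V'] [Module F V'] [Module Dᵐᵒᵖ V'] [IsScalarTower F Dᵐᵒᵖ V']

/-- `X` is in the image of the moment map iff the form `(u, v) ↦ B'(X u, v)` is pulled back from
`B`: the pulling back map is the adjoint of a preimage of `X`. -/
theorem mem_range_momentMap'_iff [FiniteDimensional F D] [Module.Finite Dᵐᵒᵖ V]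
    [Module.Finite Dᵐᵒᵖ V'] (B : EpsHermitianForm F D ε V) (B' : EpsHermitianForm F D (-ε) V')
    (X : B'.lieAlgebra) :
    X ∈ Set.range (momentMap' B B') ↔
      ∃ S : V' →ₗ[Dᵐᵒᵖ] V, ∀ u v, B.form (S u) (S v) = B'.form (X.1 u) v := by
  constructor
  · rintro ⟨T, rfl⟩
    exact ⟨adjoint B B' T, fun u v => (adjoint_spec B B' T _ _).symm⟩
  · rintro ⟨S, hS⟩
    -- the sign arises because `B` and `B'` have opposite types
    have hadj : ∀ v v', B'.form ((-adjoint B' B S) v) v' = B.form v (S v') := by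
      intro v v'
      rw [B'.herm, LinearMap.neg_apply, map_neg, ← adjoint_spec B' B S, B.herm v]
      simp
    refine ⟨-adjoint B' B S, Subtype.ext (LinearMap.ext fun u => ?_)⟩
    refine sub_eq_zero.1 (B'.nondeg _ fun v => ?_)
    rw [map_sub, LinearMap.sub_apply, sub_eq_zero, ← hS, ← hadj]
    congr 2
    refine congrArg (-adjoint B' B S) (sub_eq_zero.1 (B.nondeg_right _ fun w => ?_))
    rw [map_sub, ← adjoint_spec B B', hadj, sub_self]

/-! ### The quotient by the kernel of `X` -/

namespace Sl2Triple

variable {B : EpsHermitianForm F D ε V} (γ : Sl2Triple B) {l : ℕ} (t : Fin l → ℕ) (c : Fin l → F)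

/-- The map `⨁_j V^{γ, t_j+1}_{t_j} ⊗ S_{t_j} → V`, `v ⊗ e_i ↦ c_j / (i + 1) • Y^{i+1} v`.
The denominators absorb the coefficients in `X Y^{i+1} v = (i + 1)(t_j - i) Y^i v`: on the paired
indices `i + k + 1 = t_j` one has `t_j - i = k + 1`. -/
noncomputable def shiftMap : (∀ j, γ.mult (t j) ⊗[F] (Fin (t j) → F)) →ₗ[Dᵐᵒᵖ] V :=
  ∑ j, ∑ i : Fin (t j), (c j / ((i : ℕ) + 1)) • ((γ.Y.1 ^ ((i : ℕ) + 1)) ∘ₗ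
    (γ.mult (t j)).subtype ∘ₗ LinearMap.proj i ∘ₗ
    (tensorCoords F Dᵐᵒᵖ (γ.mult (t j)) (t j)).toLinearMap ∘ₗ LinearMap.proj j)

theorem shiftMap_apply (x : ∀ j, γ.mult (t j) ⊗[F] (Fin (t j) → F)) :
    γ.shiftMap t c x = ∑ j, ∑ i : Fin (t j), (c j / ((i : ℕ) + 1)) •
      (γ.Y.1 ^ ((i : ℕ) + 1)) (tensorCoords F Dᵐᵒᵖ (γ.mult (t j)) (t j) (x j) i : V) := by
  simp [shiftMap, LinearMap.sum_apply]

variable [CharZero F]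

theorem X_shiftMap_apply (x : ∀ j, γ.mult (t j) ⊗[F] (Fin (t j) → F)) :
    γ.X.1 (γ.shiftMap t c x) = ∑ j, ∑ i : Fin (t j), (c j * ((t j : F) - (i : ℕ))) •
      (γ.Y.1 ^ (i : ℕ)) (tensorCoords F Dᵐᵒᵖ (γ.mult (t j)) (t j) (x j) i : V) := by
  simp only [shiftMap_apply, map_sum, LinearMap.map_smul_of_tower]
  refine Finset.sum_congr rfl fun j _ => Finset.sum_congr rfl fun i _ => ?_
  rw [X_pow_succ_Y_apply (Subtype.coe_prop _), smul_smul]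
  congr 1
  have : ((i : ℕ) : F) + 1 ≠ 0 := Nat.cast_add_one_ne_zero _
  field_simp

variable {t c}

theorem X_comp_shiftMap_injective (ht : Function.Injective t) (hc : ∀ j, c j ≠ 0) :
    Function.Injective (γ.X.1 ∘ₗ γ.shiftMap t c) := by
  refine (injective_iff_map_eq_zero _).2 fun x hx => ?_
  rw [LinearMap.comp_apply, X_shiftMap_apply] at hx
  have key := γ.sl2Endos.eq_zero_of_sum_pow_Y_eq_zero ht
    (p := fun j i => (c j * ((t j : F) - (i : ℕ))) •
      (tensorCoords F Dᵐᵒᵖ (γ.mult (t j)) (t j) (x j) i : V))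
    (fun j i => by
      rw [map_smul, LinearMap.restrictScalars_apply, X_apply_of_mem_mult (Subtype.coe_prop _),
        smul_zero])
    (fun j i => by
      rw [map_smul, LinearMap.restrictScalars_apply, H_apply_of_mem_mult (Subtype.coe_prop _),
        smul_comm])
    (by simpa only [map_smul, LinearMap.restrictScalars_pow_apply] using hx)
  funext j
  refine (tensorCoords F Dᵐᵒᵖ (γ.mult (t j)) (t j)).injective ?_
  rw [Pi.zero_apply, map_zero]
  funext i
  refine Subtype.ext ((smul_eq_zero.1 (key j i)).resolve_left (mul_ne_zero (hc j) ?_))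
  exact sub_ne_zero.2 (by exact_mod_cast i.2.ne')

/-- `X` kills the part of `V` spanned by the highest weight vectors, and the rest is the image of
`shiftMap`. -/
theorem X_apply_mem_range [FiniteDimensional F D] [Module.Finite Dᵐᵒᵖ V]
    (hc : ∀ j, c j ≠ 0)
    (ht : ∀ n, 1 ≤ n → γ.isotypic (n + 1) ≠ ⊥ → n ∈ Set.range t) (v : V) :
    γ.X.1 v ∈ LinearMap.range (γ.X.1 ∘ₗ γ.shiftMap t c) := by
  classical
  have := finiteDimensional_of_finite F D V
  have htop := γ.sl2Endos.eq_top_of_pow_Y_mem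
    (((LinearMap.range (γ.X.1 ∘ₗ γ.shiftMap t c)).comap γ.X.1).restrictScalars F) ?_
  · have hv : v ∈ ((LinearMap.range (γ.X.1 ∘ₗ γ.shiftMap t c)).comap γ.X.1).restrictScalars F := by
      rw [htop]; trivial
    exact hv
  · intro n i v hi hX hH
    rw [LinearMap.restrictScalars_pow_apply]
    change γ.X.1 ((γ.Y.1 ^ i) v) ∈ LinearMap.range (γ.X.1 ∘ₗ γ.shiftMap t c)
    have hv := γ.mem_mult_of_primitive hX hH
    cases i with
    | zero =>
      rw [pow_zero, Module.End.one_apply, X_apply_of_mem_mult hv]; exact zero_mem _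
    | succ i =>
      by_cases h0 : v = 0
      · simp [h0]
      obtain ⟨j, rfl⟩ := ht n (by omega) fun hbot => h0 (by simpa [hbot] using hv.1.1)
      have hci : c j / ((i : F) + 1) ≠ 0 := div_ne_zero (hc j) (Nat.cast_add_one_ne_zero i)
      refine ⟨Pi.single j ((tensorCoords F Dᵐᵒᵖ (γ.mult (t j)) (t j)).symm
        (Pi.single ⟨i, hi⟩ ((c j / ((i : F) + 1))⁻¹ • ⟨v, hv⟩))), ?_⟩
      rw [LinearMap.comp_apply, shiftMap_apply]
      congr 1
      rw [Finset.sum_eq_single j, Finset.sum_eq_single ⟨i, hi⟩]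
      · rw [Pi.single_eq_same, LinearEquiv.apply_symm_apply, Pi.single_eq_same,
          Submodule.coe_smul_of_tower, LinearMap.map_smul_of_tower, smul_smul, mul_inv_cancel₀ hci,
          one_smul]
      · intro k _ hk
        simp [hk]
      · simp
      · intro k _ hk
        simp [hk]
      · simp

/-- The scalars `c_j` make `shiftMap` isometric for the form `(u, v) ↦ B(X u, v)`. -/
theorem form_X_shiftMap (ht : Function.Injective t) {β : ∀ m : ℕ, LinearMap.BilinForm F (Fin m → F)}
    (hβ : ∀ j, normConst (t j) (β (t j + 1)) ≠ 0)
    (hc : ∀ j (i k : Fin (t j)), β (t j) (Pi.single i 1) (Pi.single k 1) =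
      if (i : ℕ) + k + 1 = t j then
        (-1) ^ (i : ℕ) * (c j * c j * normConst (t j) (β (t j + 1))) else 0)
    (x y : ∀ j, γ.mult (t j) ⊗[F] (Fin (t j) → F)) :
    B.form (γ.X.1 (γ.shiftMap t c x)) (γ.shiftMap t c y) =
      sumForm (fun j => tensorForm (γ.multForm (t j) (β (t j + 1))) (β (t j))) x y := by
  rw [X_shiftMap_apply, shiftMap_apply]
  simp only [sumForm, LinearMap.sum_apply, LinearMap.compl₁₂_apply, LinearMap.proj_apply,
    tensorForm_eq_sum (A := Dᵐᵒᵖ), map_sum]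
  refine Finset.sum_congr rfl fun j _ => ?_
  conv_rhs => rw [Finset.sum_comm]
  refine Finset.sum_congr rfl fun k _ => ?_
  rw [Finset.sum_eq_single j]
  · refine Finset.sum_congr rfl fun i _ => ?_
    set p := tensorCoords F Dᵐᵒᵖ (γ.mult (t j)) (t j) (x j) i
    set q := tensorCoords F Dᵐᵒᵖ (γ.mult (t j)) (t j) (y j) k
    rw [hc j i k]
    simp only [map_smul, LinearMap.smul_apply, multForm, LinearMap.mk₂_apply]
    split_ifs with h
    · rw [form_pow_Y_of_add_eq (n := t j) _ _ (by omega), smul_smul, smul_smul, smul_smul]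
      congr 1
      have hk : (k : F) + 1 ≠ 0 := Nat.cast_add_one_ne_zero _
      have htk : (t j : F) = i + k + 1 := by exact_mod_cast h.symm
      have := hβ j
      rw [htk]
      field_simp
      ring
    · rw [form_pow_Y_eq_zero p.2 q.2 (fun _ h' => h (by omega))]
      simp
  · intro j' _ hj'
    refine Finset.sum_eq_zero fun i _ => ?_
    rw [map_smul, map_smul, LinearMap.smul_apply, form_pow_Y_eq_zero (Subtype.coe_prop _)
      (Subtype.coe_prop _) (fun h => absurd (ht h) hj'), smul_zero, smul_zero]
  · simp

end Sl2Triple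

end EpsHermitianForm

/-! ### Nilpotent elements in the image of the moment map -/

theorem mainTheorem6
    {F D : Type*} [Field F] [CharZero F] [DivisionRing D] [Algebra F D] [FiniteDimensional F D]
    [StarRing D] (hstar : ∀ a : F, star (algebraMap F D a) = algebraMap F D a)
    (ε : ℤˣ)
    {V : Type*} [AddCommGroup V] [Module F V] [Module Dᵐᵒᵖ V] [IsScalarTower F Dᵐᵒᵖ V]
    [Module.Finite Dᵐᵒᵖ V]
    {V' : Type*} [AddCommGroup V'] [Module F V'] [Module Dᵐᵒᵖ V'] [IsScalarTower F Dᵐᵒᵖ V']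
    [Module.Finite Dᵐᵒᵖ V']
    (B : EpsHermitianForm F D ε V) (B' : EpsHermitianForm F D (-ε) V')
    -- the fixed invariant forms on the `S_m`, compatibly normalized
    (β : ∀ m : ℕ, LinearMap.BilinForm F (Fin m → F))
    (hβ : ∀ m, 1 ≤ m → IsInvariantForm (β m))
    (hnorm : ∀ n, IsSquare (normConst n (β (n + 1)) / normConst (n + 1) (β (n + 2))))
    (γ' : EpsHermitianForm.Sl2Triple B')
    -- `t₁ > t₂ > ⋯ > t_l ≥ 1` include all `n ≥ 1` such that `n + 1` is a row length of `γ'`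
    (l : ℕ) (t : Fin l → ℕ) (ht : StrictAnti t) (ht_pos : ∀ j, 1 ≤ t j)
    (ht_all : ∀ n, 1 ≤ n → γ'.isotypic (n + 1) ≠ ⊥ → n ∈ Set.range t) :
    γ'.X ∈ Set.range (EpsHermitianForm.momentMap' B B') ↔
      ∃ f : (∀ j, γ'.mult (t j) ⊗[F] (Fin (t j) → F)) →ₗ[Dᵐᵒᵖ] V,
        Function.Injective f ∧
        ∀ x y, B.form (f x) (f y) =
          sumForm (fun j => tensorForm (γ'.multForm (t j) (β (t j + 1))) (β (t j))) x y := by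
  choose c hc0 hc using fun j => exists_scaling hβ hnorm (ht_pos j)
  have hiso := γ'.form_X_shiftMap ht.injective
    (fun j => (hβ (t j + 1) (by omega)).normConst_ne_zero) hc
  have hinj := γ'.X_comp_shiftMap_injective ht.injective hc0
  rw [EpsHermitianForm.mem_range_momentMap'_iff]
  constructor
  · rintro ⟨S, hS⟩
    refine ⟨S ∘ₗ γ'.shiftMap t c, ?_, fun x y => by
      rw [← hiso, ← hS, LinearMap.comp_apply, LinearMap.comp_apply]⟩
    refine (injective_iff_map_eq_zero _).2 fun x hx => ?_
    refine (map_eq_zero_iff _ hinj).1 (B'.nondeg _ fun v => ?_)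
    rw [LinearMap.comp_apply] at hx ⊢
    rw [← hS, hx, map_zero, LinearMap.zero_apply]
  · rintro ⟨f, -, hf⟩
    -- the projection of `V'` along `ker X'` onto the image of `shiftMap`, in coordinates
    obtain ⟨g, hg⟩ : ∃ g : V' →ₗ[Dᵐᵒᵖ] (∀ j, γ'.mult (t j) ⊗[F] (Fin (t j) → F)),
        ∀ v, γ'.X.1 (γ'.shiftMap t c (g v)) = γ'.X.1 v :=
      ⟨(LinearEquiv.ofInjective _ hinj).symm.toLinearMap ∘ₗ
        γ'.X.1.codRestrict _ (γ'.X_apply_mem_range hc0 ht_all), fun v =>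
        congrArg Subtype.val ((LinearEquiv.ofInjective _ hinj).apply_symm_apply
          (γ'.X.1.codRestrict _ (γ'.X_apply_mem_range hc0 ht_all) v))⟩
    refine ⟨f ∘ₗ g, fun u v => ?_⟩
    rw [LinearMap.comp_apply, LinearMap.comp_apply, hf, ← hiso, hg,
      EpsHermitianForm.form_apply_left_of_mem γ'.X.2, hg,
      ← EpsHermitianForm.form_apply_left_of_mem γ'.X.2]
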